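/- Let $L^2(0,1)$ be the real Hilbert space of square-integrable functions on $(0,1)$ and let $A:L^2(0,1)\to\ell^2$ be the Hausdorff moment operator $$[Ax]_j=\int_0^1 t^{j-1}x(t)\,dt\qquad(j=1,2,\dots).$$ Let $H^1(0,1)$ be the space of $x\in L^2(0,1)$ with weak derivative $x'\in L^2(0,1)$, with norm $\|x\|_{H^1(0,1)}=\big(\|x\|_{L^2(0,1)}^2+\|x'\|_{L^2(0,1)}^2\big)^{1/2}$. **Theorem.** There are constants $C>0$ and $\varepsilon>0$ such that for every $E>0$ and every $x\in H^1(0,1)$ with $\|x\|_{H^1(0,1)}\le E$, writing $\delta=\|Ax\|_{\ell^2}$, if $\delta/E\le\varepsilon$ then $$\|x\|_{L^2(0,1)}\le\frac{7}{\sqrt8}\,E\left(-\ln\left(C\,\frac{\delta}{E}\right)\right)^{-1}$$ (for $\delta=0$ the right-hand side is read as $0$). In particular, $C$ and $\varepsilon$ do not depend on $E$, $x$ or $\delta$. Consequently, $$\sup\left\{\|x\|_{L^2(0,1)} : x\in H^1(0,1),\ \|x\|_{H^1(0,1)}\le 1,\ \|Ax\|_{\ell^2}\le\delta\right\}=\mathcal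 O\!\left(\frac{1}{\ln(1/\delta)}\right)\qquad\text{as }\delta\downarrow0 .$$ -/

import Mathlib

open MeasureTheory Set Filter Topology Asymptotics
open scoped ContDiff ENNReal

noncomputable section

namespace HausdorffMoment

/-- The real Hilbert space `L²(0,1)`. -/
abbrev L2 : Type := Lp ℝ 2 (volume.restrict (Ioo (0 : ℝ) 1))

/-- The real Hilbert space `ℓ²` of square-summable sequences. -/
abbrev ell2 : Type := lp (fun _ : ℕ => ℝ) 2

/-- The moments of `x`. The index `j = 0, 1, 2, …` corresponds to the power `t ^ j`. -/
def moment (x : L2) (j : ℕ) : ℝ := ∫ t in Ioo (0 : ℝ) 1, t ^ j * x t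

/-- `g` is the weak derivative of `x` on `(0,1)`. -/
def HasWeakDeriv (x g : L2) : Prop :=
  ∀ φ : ℝ → ℝ, ContDiff ℝ ∞ φ → HasCompactSupport φ → tsupport φ ⊆ Ioo (0 : ℝ) 1 →
    ∫ t in Ioo (0 : ℝ) 1, x t * deriv φ t = -∫ t in Ioo (0 : ℝ) 1, g t * φ t

/-- Membership in the Sobolev space `H¹(0,1)`. -/
def MemH1 (x : L2) : Prop := ∃ g : L2, HasWeakDeriv x g

open Classical in
/-- The weak derivative in `L²(0,1)` of an element of `H¹(0,1)` (zero for other `x`). -/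
def weakDeriv (x : L2) : L2 := if h : MemH1 x then h.choose else 0

/-- The norm of `H¹(0,1)`; meaningful for `x` with `MemH1 x`. -/
def h1Norm (x : L2) : ℝ := Real.sqrt (‖x‖ ^ 2 + ‖weakDeriv x‖ ^ 2)

/-- The closed ball of radius `E` around zero in `H¹(0,1)`, as a subset of `L²(0,1)`. -/
def h1Ball (E : ℝ) : Set L2 := {x | MemH1 x ∧ h1Norm x ≤ E}

theorem hasWeakDeriv_weakDeriv {x : L2} (h : MemH1 x) : HasWeakDeriv x (weakDeriv x) := by
  unfold weakDeriv
  rw [dif_pos h]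
  exact h.choose_spec

/-! Square-summability of the moments, needed for the forward operator to map into `ℓ²`. -/

theorem memLp_pow (j : ℕ) :
    MemLp (fun t : ℝ => t ^ j) 2 (volume.restrict (Ioo (0 : ℝ) 1)) := by
  refine MemLp.of_bound (by fun_prop) 1 ?_
  filter_upwards [ae_restrict_mem measurableSet_Ioo] with t ht
  rw [Real.norm_eq_abs, abs_of_nonneg (pow_nonneg ht.1.le j)]
  exact pow_le_one₀ ht.1.le ht.2.le

theorem moment_eq_inner (x : L2) (j : ℕ) :
    moment x j = inner ℝ ((memLp_pow j).toLp : L2) x := by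
  rw [MeasureTheory.L2.inner_def]
  unfold moment
  refine integral_congr_ae ?_
  filter_upwards [(memLp_pow j).coeFn_toLp] with t ht
  rw [ht]
  simp [mul_comm]

theorem inner_pow (i j : ℕ) :
    inner ℝ ((memLp_pow i).toLp : L2) ((memLp_pow j).toLp : L2) = 1 / ((i : ℝ) + j + 1) := by
  rw [← moment_eq_inner]
  unfold moment
  have h : ∫ t in Ioo (0 : ℝ) 1, t ^ i * ((memLp_pow j).toLp : L2) t
      = ∫ t in Ioo (0 : ℝ) 1, t ^ (i + j) := by
    refine integral_congr_ae ?_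
    filter_upwards [(memLp_pow j).coeFn_toLp] with t ht
    rw [ht, pow_add]
  rw [h, ← integral_Ioc_eq_integral_Ioo, ← intervalIntegral.integral_of_le zero_le_one,
    integral_pow]
  simp

theorem schur_sum (i n : ℕ) :
    ∑ j ∈ Finset.range n, 1 / (((i : ℝ) + j + 1) * √((j : ℝ) + 1)) ≤ 8 / √((i : ℝ) + 1) := by
  set b := √((i : ℝ) + 1) with hb
  have hb0 : 0 < b := Real.sqrt_pos.2 (by positivity)
  have hb2 : b ^ 2 = (i : ℝ) + 1 := Real.sq_sqrt (by positivity)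
  have key : ∑ j ∈ Finset.range n, 1 / (((i : ℝ) + j + 1) * √((j : ℝ) + 1))
      ≤ 8 / b * (√(n : ℝ) / (√(n : ℝ) + b)) := by
    induction n with
    | zero => simp
    | succ k ih =>
      rw [Finset.sum_range_succ]
      set u := √(k : ℝ) with hu
      set v := √((k : ℝ) + 1) with hv
      have hv' : √((k + 1 : ℕ) : ℝ) = v := by push_cast; rfl
      rw [hv']
      have hu0 : 0 ≤ u := Real.sqrt_nonneg _
      have hv0 : 0 < v := Real.sqrt_pos.2 (by positivity)
      have hu2 : u ^ 2 = (k : ℝ) := Real.sq_sqrt (by positivity)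
      have hv2 : v ^ 2 = (k : ℝ) + 1 := Real.sq_sqrt (by positivity)
      have huv : u ≤ v := Real.sqrt_le_sqrt (by linarith)
      have hi : (i : ℝ) + k + 1 = b ^ 2 + u ^ 2 := by rw [hb2, hu2]; ring
      have hstep : 1 / (((i : ℝ) + k + 1) * v)
          ≤ 8 / b * (v / (v + b)) - 8 / b * (u / (u + b)) := by
        have hdiff : 8 / b * (v / (v + b)) - 8 / b * (u / (u + b))
            = 8 / ((v + u) * ((v + b) * (u + b))) := by
          have h1 : (v - u) * (v + u) = 1 := by nlinarith
          have h2 : v - u = 1 / (v + u) := by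
            rw [eq_div_iff (by positivity)]; exact h1
          have h3 : 8 / b * (v / (v + b)) - 8 / b * (u / (u + b))
              = 8 * (v - u) / ((v + b) * (u + b)) := by
            field_simp; ring
          rw [h3, h2]; field_simp
        rw [hdiff, hi, div_le_div_iff₀ (by positivity) (by positivity)]
        have h4 : (v + b) * (u + b) ≤ 4 * (b ^ 2 + u ^ 2) := by
          have hi0 : (0 : ℝ) ≤ i := by positivity
          nlinarith [sq_nonneg (v - b), mul_le_mul_of_nonneg_left (add_le_add_left huv b)
            (add_pos hv0 hb0).le]
        have h5 : v + u ≤ 2 * v := by linarith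
        have := mul_le_mul h5 h4 (by positivity) (by positivity)
        linarith
      linarith
  refine key.trans ?_
  have : √(n : ℝ) / (√(n : ℝ) + b) ≤ 1 := by
    rw [div_le_one (by positivity)]; linarith
  exact mul_le_of_le_one_right (by positivity) this

theorem hilbert_form_le (a : ℕ → ℝ) (n : ℕ) :
    ∑ i ∈ Finset.range n, ∑ j ∈ Finset.range n, a i * a j * (1 / ((i : ℝ) + j + 1))
      ≤ 8 * ∑ i ∈ Finset.range n, a i ^ 2 := by
  set F : ℕ → ℕ → ℝ := fun i j => a i ^ 2 * √((i : ℝ) + 1) *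
    (1 / (((i : ℝ) + j + 1) * √((j : ℝ) + 1))) with hF
  have hterm : ∀ i j : ℕ, a i * a j * (1 / ((i : ℝ) + j + 1)) ≤ (F i j + F j i) / 2 := by
    intro i j
    have hp : 0 < √((i : ℝ) + 1) := Real.sqrt_pos.2 (by positivity)
    have hq : 0 < √((j : ℝ) + 1) := Real.sqrt_pos.2 (by positivity)
    simp only [hF]
    set p := √((i : ℝ) + 1)
    set q := √((j : ℝ) + 1)
    have hm : (0 : ℝ) < (i : ℝ) + j + 1 := by positivity
    have e : (j : ℝ) + i + 1 = (i : ℝ) + j + 1 := by ring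
    rw [e]
    set m := (i : ℝ) + j + 1
    have : (a i ^ 2 * p * (1 / (m * q)) + a j ^ 2 * q * (1 / (m * p))) / 2
        - a i * a j * (1 / m) = (a i * p - a j * q) ^ 2 / (2 * m * p * q) := by
      field_simp; ring
    have h2 : 0 ≤ (a i * p - a j * q) ^ 2 / (2 * m * p * q) := by positivity
    linarith
  have hrow : ∑ i ∈ Finset.range n, ∑ j ∈ Finset.range n, F i j
      ≤ 8 * ∑ i ∈ Finset.range n, a i ^ 2 := by
    rw [Finset.mul_sum]
    refine Finset.sum_le_sum fun i _ => ?_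
    simp only [hF]
    rw [← Finset.mul_sum]
    have hp : 0 < √((i : ℝ) + 1) := Real.sqrt_pos.2 (by positivity)
    calc _ ≤ a i ^ 2 * √((i : ℝ) + 1) * (8 / √((i : ℝ) + 1)) :=
          mul_le_mul_of_nonneg_left (schur_sum i n) (by positivity)
      _ = 8 * a i ^ 2 := by field_simp
  calc _ ≤ ∑ i ∈ Finset.range n, ∑ j ∈ Finset.range n, (F i j + F j i) / 2 :=
        Finset.sum_le_sum fun i _ => Finset.sum_le_sum fun j _ => hterm i j
    _ = ∑ i ∈ Finset.range n, ∑ j ∈ Finset.range n, F i j := by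
        simp only [← Finset.sum_div, Finset.sum_add_distrib]
        rw [Finset.sum_comm (f := fun i j => F j i)]
        ring
    _ ≤ _ := hrow

theorem sum_moment_sq_le (x : L2) (n : ℕ) :
    ∑ j ∈ Finset.range n, moment x j ^ 2 ≤ 8 * ‖x‖ ^ 2 := by
  set S := ∑ j ∈ Finset.range n, moment x j ^ 2 with hS
  have hS0 : 0 ≤ S := Finset.sum_nonneg fun _ _ => sq_nonneg _
  set p : L2 := ∑ j ∈ Finset.range n, moment x j • ((memLp_pow j).toLp : L2) with hp
  have h1 : S = inner ℝ p x := by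
    rw [hp, sum_inner]
    refine Finset.sum_congr rfl fun j _ => ?_
    rw [real_inner_smul_left, ← moment_eq_inner, sq]
  have h2 : ‖p‖ ^ 2 ≤ 8 * S := by
    rw [← real_inner_self_eq_norm_sq, hp, sum_inner]
    refine le_trans (le_of_eq ?_) (hilbert_form_le (moment x) n)
    refine Finset.sum_congr rfl fun i _ => ?_
    rw [inner_sum]
    refine Finset.sum_congr rfl fun j _ => ?_
    rw [real_inner_smul_left, real_inner_smul_right, inner_pow]
    ring
  have h3 : S ≤ ‖p‖ * ‖x‖ := h1 ▸ real_inner_le_norm p x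
  have h4 : S * S ≤ S * (8 * ‖x‖ ^ 2) := by
    calc S * S ≤ (‖p‖ * ‖x‖) * (‖p‖ * ‖x‖) := mul_self_le_mul_self hS0 h3
      _ = ‖p‖ ^ 2 * ‖x‖ ^ 2 := by ring
      _ ≤ (8 * S) * ‖x‖ ^ 2 := by gcongr
      _ = S * (8 * ‖x‖ ^ 2) := by ring
  rcases hS0.eq_or_lt with h | h
  · rw [← h]; positivity
  · exact le_of_mul_le_mul_left h4 h

theorem memℓp_moment (x : L2) : Memℓp (moment x) 2 := by
  refine memℓp_gen ?_
  have : Summable fun j => moment x j ^ 2 :=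
    summable_of_sum_range_le (fun _ => sq_nonneg _) (sum_moment_sq_le x)
  refine this.congr fun j => ?_
  simp

theorem sum_norm_moment_rpow_le (x : L2) (s : Finset ℕ) :
    ∑ j ∈ s, ‖moment x j‖ ^ (2 : ℝ≥0∞).toReal ≤ (3 * ‖x‖) ^ (2 : ℝ≥0∞).toReal := by
  have e : ∀ j, ‖moment x j‖ ^ (2 : ℝ≥0∞).toReal = moment x j ^ 2 := fun j => by simp
  obtain ⟨n, hn⟩ := s.exists_nat_subset_range
  calc _ = ∑ j ∈ s, moment x j ^ 2 := Finset.sum_congr rfl fun j _ => e j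
    _ ≤ ∑ j ∈ Finset.range n, moment x j ^ 2 :=
        Finset.sum_le_sum_of_subset_of_nonneg hn fun _ _ _ => sq_nonneg _
    _ ≤ 8 * ‖x‖ ^ 2 := sum_moment_sq_le x n
    _ ≤ (3 * ‖x‖) ^ 2 := by nlinarith [sq_nonneg ‖x‖]
    _ = _ := by simp

/-- The forward operator `A : L²(0,1) → ℓ²` of the Hausdorff moment problem,
`(A x)_j = ∫₀¹ t ^ j x(t) dt` for `j = 0, 1, 2, …`. -/
def A : L2 →L[ℝ] ell2 :=
  LinearMap.mkContinuous
    { toFun := fun x => ⟨moment x, memℓp_moment x⟩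
      map_add' := fun x y => by
        ext j
        change moment (x + y) j = moment x j + moment y j
        simp only [moment_eq_inner, inner_add_right]
      map_smul' := fun c x => by
        ext j
        change moment (c • x) j = c * moment x j
        simp only [moment_eq_inner, real_inner_smul_right] }
    3 fun x => lp.norm_le_of_forall_sum_le (by norm_num) (by positivity)
      (sum_norm_moment_rpow_le x)

theorem A_apply (x : L2) (j : ℕ) : A x j = ∫ t in Ioo (0 : ℝ) 1, t ^ j * x t := rfl

/-- The modulus of continuity
`ω_M(δ) = sup {‖x‖ : x ∈ M, ‖A x‖ ≤ δ}`. -/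
def modulus (M : Set L2) (δ : ℝ) : ℝ := sSup {r : ℝ | ∃ x ∈ M, ‖A x‖ ≤ δ ∧ r = ‖x‖}

/-- The supremum defining the modulus of continuity on an `H¹`-ball is over a bounded set. -/
theorem bddAbove_modulus_set (E δ : ℝ) :
    BddAbove {r : ℝ | ∃ x ∈ h1Ball E, ‖A x‖ ≤ δ ∧ r = ‖x‖} := by
  refine ⟨E, ?_⟩
  rintro r ⟨x, hx, -, rfl⟩
  exact (Real.le_sqrt_of_sq_le (by nlinarith [sq_nonneg ‖weakDeriv x‖])).trans hx.2

end HausdorffMoment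

end

/-! Expand `x` in the shifted Legendre polynomials L_k and cut the expansion at degree n.

Low degrees: the inner product of L_k with `x` is a combination of moments. The coefficients of L_k
have absolute sum at most 8^k, while its norm decays at most exponentially, so the part of `x` of
degree below n is at most 16^n ‖Ax‖ (`sum_legendreEnergy_le`).

High degrees: L_k is an eigenfunction of the operator -(t(1-t)u')' with eigenvalue k(k+1). The
functions √(t(1-t)) L_k' are therefore orthogonal too, and Bessel's inequality for √(t(1-t)) x'
bounds the sum of k(k+1) times the energies by ‖x'‖²/4. The part of degree at least n is thus at
most ‖x'‖/(2n) (`HasWeakDeriv.sum_mul_legendreEnergy_le`).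

Parseval joins the two parts (`HasWeakDeriv.norm_le`). With l = -ln(δ/E), taking n close to l/4
makes the first term exponentially small in l and the second about 2E/l, which is below 7E/(√8 l).
-/

noncomputable section

namespace HausdorffMoment

open Polynomial

/-! ### Shifted Legendre polynomials: coefficients and differential equation -/

/-- The shifted Legendre polynomials with real coefficients. -/
def legendre (k : ℕ) : ℝ[X] := (shiftedLegendre k).map (Int.castRingHom ℝ)

theorem coeff_legendre (k j : ℕ) :
    (legendre k).coeff j = (-1) ^ j * (k.choose j : ℝ) * ((k + j).choose k : ℝ) := by
  simp [legendre, coeff_shiftedLegendre]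

theorem natDegree_legendre_le (k : ℕ) : (legendre k).natDegree ≤ k :=
  natDegree_map_le.trans (natDegree_shiftedLegendre k).le

theorem legendre_eval_zero (k : ℕ) : (legendre k).eval 0 = 1 := by
  rw [← coeff_zero_eq_eval_zero, coeff_legendre]; simp

theorem coeff_legendre_self_ne_zero (k : ℕ) : (legendre k).coeff k ≠ 0 := by
  rw [coeff_legendre]
  have : (k + k).choose k ≠ 0 := (Nat.choose_pos (by omega)).ne'
  simp [this]

/-- This recursion is the Legendre equation read coefficientwise; it stays valid for j ≥ k, where
the left side vanishes. -/
theorem coeff_legendre_succ (k j : ℕ) :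
    ((j : ℝ) + 1) ^ 2 * (legendre k).coeff (j + 1)
      = ((j : ℝ) * (j + 1) - k * (k + 1)) * (legendre k).coeff j := by
  rw [coeff_legendre, coeff_legendre]
  have h1 : (k.choose (j + 1) : ℝ) * (j + 1) = k.choose j * ((k : ℝ) - j) := by
    rcases le_or_gt j k with h | h
    · have := Nat.choose_succ_right_eq k j
      rw [← Nat.cast_sub h]
      exact_mod_cast this
    · rw [Nat.choose_eq_zero_of_lt h, Nat.choose_eq_zero_of_lt (by omega)]; simp
  have h2 : ((k + (j + 1)).choose k : ℝ) * (j + 1) = (k + j).choose k * ((k : ℝ) + j + 1) := by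
    have h := Nat.add_one_mul_choose_eq (k + j) j
    rw [← Nat.choose_symm_add (a := k) (b := j), add_assoc k j 1,
      ← Nat.choose_symm_add (a := k) (b := j + 1)] at h
    have h' : (((k + (j + 1) : ℕ) : ℝ)) * ((k + j).choose k : ℕ)
      = ((k + (j + 1)).choose k : ℕ) * ((j + 1 : ℕ) : ℝ) := by exact_mod_cast h
    push_cast at h'
    linarith
  rw [pow_succ (-1 : ℝ) j]
  linear_combination (-(-1 : ℝ) ^ j * (((k + (j + 1)).choose k : ℝ) * (j + 1))) * h1
    - (-1 : ℝ) ^ j * (k.choose j * ((k : ℝ) - j)) * h2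

/-- The Legendre differential equation in divergence form. -/
theorem legendre_ode (k : ℕ) :
    derivative (X * (1 - X) * derivative (legendre k))
      = -C ((k : ℝ) * (k + 1)) * legendre k := by
  have e : X * (1 - X) * derivative (legendre k)
      = X * derivative (legendre k) - X * (X * derivative (legendre k)) := by ring
  rw [e]
  ext j
  have h := coeff_legendre_succ k j
  rw [neg_mul, coeff_neg, coeff_C_mul, coeff_derivative, coeff_sub, coeff_X_mul, coeff_X_mul,
    coeff_derivative]
  rcases j with _ | i
  · simp only [mul_coeff_zero, coeff_X_zero, zero_mul]
    simp only [Nat.cast_zero] at h ⊢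
    linear_combination h
  · rw [coeff_X_mul, coeff_derivative]
    push_cast at h ⊢
    linear_combination h

theorem sum_abs_coeff_legendre_le (k : ℕ) :
    ∑ j ∈ Finset.range (k + 1), |(legendre k).coeff j| ≤ 8 ^ k := by
  calc _ ≤ ∑ j ∈ Finset.range (k + 1), (k.choose j : ℝ) * 4 ^ k := by
        refine Finset.sum_le_sum fun j hj => ?_
        have hj' : j ≤ k := Nat.lt_succ_iff.1 (Finset.mem_range.1 hj)
        rw [coeff_legendre, abs_mul, abs_mul, abs_pow, abs_neg, abs_one, one_pow, one_mul,
          Nat.abs_cast, Nat.abs_cast]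
        refine mul_le_mul_of_nonneg_left ?_ (Nat.cast_nonneg _)
        have h1 : (k + j).choose k ≤ 2 ^ (k + j) := Nat.choose_le_two_pow _ _
        have h2 : 2 ^ (k + j) ≤ 2 ^ (2 * k) := Nat.pow_le_pow_right (by norm_num) (by omega)
        rw [pow_mul] at h2
        exact_mod_cast h1.trans h2
    _ = 2 ^ k * 4 ^ k := by
        rw [← Finset.sum_mul]
        congr 1
        exact_mod_cast Nat.sum_range_choose k
    _ = 8 ^ k := by rw [← mul_pow]; norm_num

/-! ### Orthogonality and a lower bound for the norms -/

theorem integral_derivative_eval (p : ℝ[X]) :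
    ∫ t in (0 : ℝ)..1, (derivative p).eval t = p.eval 1 - p.eval 0 :=
  intervalIntegral.integral_eq_sub_of_hasDerivAt (fun t _ => p.hasDerivAt t)
    ((derivative p).continuous.intervalIntegrable _ _)

theorem intervalIntegrable_eval (p : ℝ[X]) (a b : ℝ) :
    IntervalIntegrable (fun t => p.eval t) volume a b := p.continuous.intervalIntegrable _ _

/-- The integral over the unit interval as a linear functional on polynomials. -/
def polyIntegral : ℝ[X] →ₗ[ℝ] ℝ where
  toFun p := ∫ t in (0 : ℝ)..1, p.eval t
  map_add' p q := by
    simp only [eval_add]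
    exact intervalIntegral.integral_add (intervalIntegrable_eval p 0 1)
      (intervalIntegrable_eval q 0 1)
  map_smul' c p := by simp

theorem polyIntegral_apply (p : ℝ[X]) : polyIntegral p = ∫ t in (0 : ℝ)..1, p.eval t := rfl

theorem polyIntegral_derivative (p : ℝ[X]) :
    polyIntegral (derivative p) = p.eval 1 - p.eval 0 := integral_derivative_eval p

theorem polyIntegral_C_mul (c : ℝ) (p : ℝ[X]) : polyIntegral (C c * p) = c * polyIntegral p := by
  rw [← smul_eq_C_mul, map_smul, smul_eq_mul]

theorem polyIntegral_sq_nonneg (p : ℝ[X]) : 0 ≤ polyIntegral (p ^ 2) := by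
  rw [polyIntegral_apply]
  refine intervalIntegral.integral_nonneg zero_le_one fun t _ => ?_
  rw [eval_pow]; positivity

/-- Integration by parts: the weight X(1-X) kills the boundary terms. -/
theorem polyIntegral_weighted (j k : ℕ) :
    polyIntegral (X * (1 - X) * derivative (legendre j) * derivative (legendre k))
      = (j : ℝ) * (j + 1) * polyIntegral (legendre j * legendre k) := by
  have h := polyIntegral_derivative (X * (1 - X) * derivative (legendre j) * legendre k)
  rw [derivative_mul, legendre_ode, map_add, neg_mul, neg_mul, mul_assoc (C _), map_neg,
    polyIntegral_C_mul] at h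
  simp only [eval_mul, eval_X, eval_sub, eval_one] at h
  linarith

/-- The weighted form is symmetric in j and k, and the eigenvalues k(k+1) are distinct. -/
theorem polyIntegral_legendre_mul {j k : ℕ} (h : j ≠ k) :
    polyIntegral (legendre j * legendre k) = 0 := by
  have h1 := polyIntegral_weighted j k
  have h2 := polyIntegral_weighted k j
  rw [mul_comm (legendre k), mul_right_comm] at h2
  have h3 : ((j : ℝ) * (j + 1) - k * (k + 1)) * polyIntegral (legendre j * legendre k) = 0 := by
    linarith
  refine (mul_eq_zero.1 h3).resolve_left fun h4 => h ?_
  have h5 : ((j : ℝ) - k) * (j + k + 1) = 0 := by linarith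
  have h6 : (j : ℝ) + k + 1 ≠ 0 := by positivity
  exact_mod_cast sub_eq_zero.1 ((mul_eq_zero.1 h5).resolve_right h6)

/-- A crude bound suffices, since any exponential loss is affordable later. It rests on P(0) = 1 and
the differential equation, without computing the norm. -/
theorem polyIntegral_legendre_sq_ge (k : ℕ) :
    1 ≤ ((k : ℝ) * (k + 1) + 2) ^ 2 * polyIntegral (legendre k ^ 2) := by
  set l : ℝ := (k : ℝ) * (k + 1) with hl
  have hl0 : 0 ≤ l := by positivity
  set P := legendre k with hP
  set N := polyIntegral (P ^ 2) with hN
  set M := polyIntegral ((1 - X) * P * derivative P) with hM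
  have h1 : 2 * M - N = -1 := by
    have h := polyIntegral_derivative ((1 - X) * P ^ 2)
    have e : derivative ((1 - X) * P ^ 2) = C 2 * ((1 - X) * P * derivative P) - P ^ 2 := by
      simp only [derivative_mul, derivative_sub, derivative_one, derivative_X, derivative_pow]
      have c2 : (C (2 : ℝ) : ℝ[X]) = 2 := map_ofNat C 2
      norm_num
      rw [c2]
      ring
    rw [e, map_sub, polyIntegral_C_mul] at h
    simp [hP, legendre_eval_zero] at h
    simpa [hM, hN, hP] using h
  have h2 : polyIntegral (((1 - X) * derivative P) ^ 2) = -2 * l * M := by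
    have h := polyIntegral_derivative ((1 - X) * (derivative P) * (X * (1 - X) * derivative P))
    have e : derivative ((1 - X) * (derivative P) * (X * (1 - X) * derivative P))
        = -((1 - X) * derivative P) ^ 2 + C (-2 * l) * ((1 - X) * P * derivative P) := by
      have o := legendre_ode k
      rw [← hP, ← hl] at o
      rw [derivative_mul, o]
      have o2 : X * (1 - X) * derivative (derivative P)
          = -C l * P - (1 - 2 * X) * derivative P := by
        rw [← o]
        simp only [derivative_mul, derivative_sub, derivative_one, derivative_X]
        ring
      have e2 : C (-2 * l) = -2 * (C l : ℝ[X]) := by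
        rw [C_mul, C_neg, map_ofNat]
      rw [e2]
      simp only [derivative_mul, derivative_sub, derivative_one, derivative_X]
      linear_combination ((1 - X) * derivative P) * o2
    rw [e, map_add, map_neg, polyIntegral_C_mul] at h
    simp only [eval_mul, eval_X, eval_sub, eval_one] at h
    linarith
  -- The multiplier l + 1 leaves exactly 2M, which equals N - 1 by `h1`; hence ((l + 1)² + 1) N ≥ 1.
  have h3 : 0 ≤ (l + 1) ^ 2 * N + 2 * (l + 1) * M + -2 * l * M := by
    have h := polyIntegral_sq_nonneg (C (l + 1) * P + (1 - X) * derivative P)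
    have e : (C (l + 1) * P + (1 - X) * derivative P) ^ 2 = C ((l + 1) ^ 2) * P ^ 2
        + C (2 * (l + 1)) * ((1 - X) * P * derivative P) + ((1 - X) * derivative P) ^ 2 := by
      have e2 : C (2 * (l + 1)) = 2 * (C (l + 1) : ℝ[X]) := by
        rw [C_mul, map_ofNat]
      rw [e2, C_pow]
      ring
    rwa [e, map_add, map_add, polyIntegral_C_mul, polyIntegral_C_mul, h2] at h
  have hN0 : 0 ≤ N := polyIntegral_sq_nonneg P
  nlinarith

/-! ### Polynomials in L² and uniqueness for the moment problem -/

theorem memLp_of_continuous {f : ℝ → ℝ} (hf : Continuous f) :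
    MemLp f 2 (volume.restrict (Ioo (0 : ℝ) 1)) := by
  obtain ⟨K, hK⟩ := (isCompact_Icc (a := (0 : ℝ)) (b := 1)).exists_bound_of_continuousOn
    hf.continuousOn
  refine MemLp.of_bound hf.aestronglyMeasurable K ?_
  filter_upwards [ae_restrict_mem measurableSet_Ioo] with t ht
  exact hK t (Ioo_subset_Icc_self ht)

theorem integrable_continuous_mul {f : ℝ → ℝ} (hf : Continuous f) (x : L2) :
    Integrable (fun t => f t * x t) (volume.restrict (Ioo (0 : ℝ) 1)) :=
  (memLp_of_continuous hf).integrable_mul (Lp.memLp x)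

/-- A continuous function as an element of `L²(0,1)`. -/
def contLp (f : ℝ → ℝ) (hf : Continuous f) : L2 := (memLp_of_continuous hf).toLp

theorem inner_contLp {f : ℝ → ℝ} (hf : Continuous f) (x : L2) :
    inner ℝ (contLp f hf) x = ∫ t in Ioo (0 : ℝ) 1, f t * x t := by
  rw [MeasureTheory.L2.inner_def]
  refine integral_congr_ae ?_
  filter_upwards [(memLp_of_continuous hf).coeFn_toLp] with t ht
  simp only [contLp, ht]
  simp [mul_comm]

theorem inner_contLp_contLp {f g : ℝ → ℝ} (hf : Continuous f) (hg : Continuous g) :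
    inner ℝ (contLp f hf) (contLp g hg) = ∫ t in (0 : ℝ)..1, f t * g t := by
  rw [inner_contLp, intervalIntegral.integral_of_le zero_le_one, integral_Ioc_eq_integral_Ioo]
  refine integral_congr_ae ?_
  filter_upwards [(memLp_of_continuous hg).coeFn_toLp] with t ht
  simp only [contLp, ht]

/-- A polynomial as an element of `L²(0,1)`. -/
def polyLp (p : ℝ[X]) : L2 := contLp (fun t => p.eval t) p.continuous

theorem inner_polyLp_polyLp (p q : ℝ[X]) :
    inner ℝ (polyLp p) (polyLp q) = polyIntegral (p * q) := by
  rw [polyLp, polyLp, inner_contLp_contLp, polyIntegral_apply]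
  simp only [eval_mul]

theorem integral_eval_mul (p : ℝ[X]) {n : ℕ} (hn : p.natDegree < n) (x : L2) :
    ∫ t in Ioo (0 : ℝ) 1, p.eval t * x t = ∑ j ∈ Finset.range n, p.coeff j * moment x j := by
  simp only [eval_eq_sum_range' hn, Finset.sum_mul, mul_assoc]
  rw [integral_finsetSum]
  · simp only [integral_const_mul, moment]
  · intro j _
    exact (integrable_continuous_mul (continuous_pow j) x).const_mul _

theorem inner_polyLp (p : ℝ[X]) {n : ℕ} (hn : p.natDegree < n) (x : L2) :
    inner ℝ (polyLp p) x = ∑ j ∈ Finset.range n, p.coeff j * moment x j := by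
  rw [polyLp, inner_contLp, integral_eval_mul p hn]

/-- L_k has degree exactly k, so the system relating these inner products to the moments is
triangular. -/
theorem moment_eq_zero_of_inner_legendre {x : L2}
    (h : ∀ k, inner ℝ (polyLp (legendre k)) x = 0) (j : ℕ) : moment x j = 0 := by
  induction j using Nat.strong_induction_on with
  | _ k ih =>
    have h1 := h k
    rw [inner_polyLp _ (Nat.lt_succ_of_le (natDegree_legendre_le k)), Finset.sum_range_succ,
      Finset.sum_eq_zero, zero_add] at h1
    · exact (mul_eq_zero.1 h1).resolve_left (coeff_legendre_self_ne_zero k)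
    · intro j hj
      rw [ih j (Finset.mem_range.1 hj), mul_zero]

/-- A square-integrable function is determined by its moments. -/
theorem eq_zero_of_moment_eq_zero {x : L2} (h : ∀ j, moment x j = 0) : x = 0 := by
  have hx : Integrable x (volume.restrict (Ioo (0 : ℝ) 1)) := by
    simpa using integrable_continuous_mul (f := fun _ => 1) continuous_const x
  refine (Lp.eq_zero_iff_ae_eq_zero).2 (ae_eq_zero_of_integral_contDiff_smul_eq_zero
    hx.locallyIntegrable fun f hf _ => ?_)
  simp only [smul_eq_mul]
  have hp (p : ℝ[X]) : ∫ t in Ioo (0 : ℝ) 1, p.eval t * x t = 0 := by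
    rw [integral_eval_mul p (Nat.lt_succ_self _)]
    simp [h]
  set I := ∫ t in Ioo (0 : ℝ) 1, ‖x t‖ with hI
  have hI0 : 0 ≤ I := integral_nonneg fun _ => norm_nonneg _
  have hb : ∀ ε : ℝ, 0 < ε → ‖∫ t in Ioo (0 : ℝ) 1, f t * x t‖ ≤ ε * I := by
    intro ε hε
    -- Weierstrass approximation: `p` integrates to zero against `x`, so only the uniform error of
    -- `f - p` remains.
    obtain ⟨p, hpf⟩ := exists_polynomial_near_of_continuousOn 0 1 f
      hf.continuous.continuousOn ε hε
    have e : ∫ t in Ioo (0 : ℝ) 1, f t * x t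
        = ∫ t in Ioo (0 : ℝ) 1, (f t * x t - p.eval t * x t) := by
      rw [integral_sub (integrable_continuous_mul hf.continuous x)
        (integrable_continuous_mul p.continuous x), hp, sub_zero]
    rw [e, hI, ← integral_const_mul]
    refine norm_integral_le_of_norm_le (hx.norm.const_mul ε) ?_
    filter_upwards [ae_restrict_mem measurableSet_Ioo] with t ht
    rw [← sub_mul, norm_mul, Real.norm_eq_abs, abs_sub_comm]
    gcongr
    exact (hpf t (Ioo_subset_Icc_self ht)).le
  refine norm_le_zero_iff.1 (le_of_forall_pos_le_add fun ε hε => ?_)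
  refine (hb (ε / (I + 1)) (by positivity)).trans ?_
  rw [zero_add, div_mul_eq_mul_div, div_le_iff₀ (by positivity)]
  nlinarith

/-! ### Cutoff functions and polynomial test functions -/

theorem deriv_smoothTransition_of_lt {y : ℝ} (hy : y < 0) :
    deriv Real.smoothTransition y = 0 := by
  have : Real.smoothTransition =ᶠ[𝓝 y] fun _ => 0 := by
    filter_upwards [Iio_mem_nhds hy] with z hz
    exact Real.smoothTransition.zero_of_nonpos (le_of_lt hz)
  rw [this.deriv_eq, deriv_const]

theorem deriv_smoothTransition_of_gt {y : ℝ} (hy : 1 < y) :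
    deriv Real.smoothTransition y = 0 := by
  have : Real.smoothTransition =ᶠ[𝓝 y] fun _ => 1 := by
    filter_upwards [Ioi_mem_nhds hy] with z hz
    exact Real.smoothTransition.one_of_one_le (le_of_lt hz)
  rw [this.deriv_eq, deriv_const]

theorem continuous_deriv_smoothTransition : Continuous (deriv Real.smoothTransition) :=
  (Real.smoothTransition.contDiff (n := 1)).continuous_deriv le_rfl

/-- With y = ct - 1 the product is ct times the derivative at ct - 1, so this bound is uniform in
the scale c. -/
theorem exists_bound_mul_deriv_smoothTransition :
    ∃ M : ℝ, 0 ≤ M ∧ ∀ y : ℝ, |(y + 1) * deriv Real.smoothTransition y| ≤ M := by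
  obtain ⟨M, hM⟩ := (isCompact_Icc (a := (0 : ℝ)) (b := 1)).exists_bound_of_continuousOn
    (f := fun y => (y + 1) * deriv Real.smoothTransition y)
    (((continuous_id.add continuous_const).mul continuous_deriv_smoothTransition).continuousOn)
  have hM0 : 0 ≤ M := (norm_nonneg _).trans (hM 0 ⟨le_rfl, zero_le_one⟩)
  refine ⟨M, hM0, fun y => ?_⟩
  rcases lt_or_ge y 0 with h | h
  · rw [deriv_smoothTransition_of_lt h]; simpa
  rcases lt_or_ge 1 y with h' | h'
  · rw [deriv_smoothTransition_of_gt h']; simpa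
  exact hM y ⟨h, h'⟩

/-- A smooth cutoff function supported in `[1 / c, 1 - 1 / c]`. -/
def cutoff (c t : ℝ) : ℝ :=
  Real.smoothTransition (c * t - 1) * Real.smoothTransition (c * (1 - t) - 1)

/-- The derivative of `cutoff c`. -/
def cutoffDeriv (c t : ℝ) : ℝ :=
  c * deriv Real.smoothTransition (c * t - 1) * Real.smoothTransition (c * (1 - t) - 1)
    - Real.smoothTransition (c * t - 1) * (c * deriv Real.smoothTransition (c * (1 - t) - 1))

theorem contDiff_cutoff (c : ℝ) : ContDiff ℝ ∞ (cutoff c) := by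
  have h : ContDiff ℝ ∞ Real.smoothTransition := Real.smoothTransition.contDiff
  unfold cutoff
  exact (h.comp (by fun_prop)).mul (h.comp (by fun_prop))

theorem hasDerivAt_cutoff (c t : ℝ) : HasDerivAt (cutoff c) (cutoffDeriv c t) t := by
  have hS (y : ℝ) : HasDerivAt Real.smoothTransition (deriv Real.smoothTransition y) y :=
    (Real.smoothTransition.contDiff (n := 1)).differentiable one_ne_zero y |>.hasDerivAt
  have h1 : HasDerivAt (fun t : ℝ => c * t - 1) c t := by
    simpa using ((hasDerivAt_id t).const_mul c).sub_const 1
  have h2 : HasDerivAt (fun t : ℝ => c * (1 - t) - 1) (-c) t := by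
    simpa using (((hasDerivAt_id t).const_sub 1).const_mul c).sub_const 1
  have := ((hS _).comp t h1).mul ((hS _).comp t h2)
  refine this.congr_deriv ?_
  simp only [cutoffDeriv, Function.comp]
  ring

theorem cutoff_nonneg (c t : ℝ) : 0 ≤ cutoff c t :=
  mul_nonneg (Real.smoothTransition.nonneg _) (Real.smoothTransition.nonneg _)

theorem cutoff_le_one (c t : ℝ) : cutoff c t ≤ 1 :=
  mul_le_one₀ (Real.smoothTransition.le_one _) (Real.smoothTransition.nonneg _)
    (Real.smoothTransition.le_one _)

theorem support_cutoff_subset (c : ℝ) :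
    Function.support (cutoff c) ⊆ {t | 1 ≤ c * t} ∩ {t | 1 ≤ c * (1 - t)} := by
  intro t ht
  have h := mul_ne_zero_iff.1 (Function.mem_support.1 ht)
  rw [ne_eq, Real.smoothTransition.zero_iff_nonpos, ne_eq,
    Real.smoothTransition.zero_iff_nonpos] at h
  constructor
  · change 1 ≤ c * t
    linarith [h.1]
  · change 1 ≤ c * (1 - t)
    linarith [h.2]

theorem tsupport_mul_cutoff_subset (f : ℝ → ℝ) {c : ℝ} (hc : 0 ≤ c) :
    tsupport (fun t => f t * cutoff c t) ⊆ Ioo 0 1 := by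
  have h1 : tsupport (fun t => f t * cutoff c t)
      ⊆ {t | 1 ≤ c * t} ∩ {t | 1 ≤ c * (1 - t)} := by
    refine closure_minimal ?_ ((isClosed_le (by fun_prop) (by fun_prop)).inter
      (isClosed_le (by fun_prop) (by fun_prop)))
    exact fun t ht => support_cutoff_subset c (right_ne_zero_of_mul ht)
  refine h1.trans fun t ht => ?_
  obtain ⟨h2 : 1 ≤ c * t, h3 : 1 ≤ c * (1 - t)⟩ := ht
  constructor
  · by_contra h; nlinarith
  · by_contra h; nlinarith

theorem hasCompactSupport_mul_cutoff (f : ℝ → ℝ) {c : ℝ} (hc : 0 ≤ c) :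
    HasCompactSupport fun t => f t * cutoff c t :=
  isCompact_Icc.of_isClosed_subset (isClosed_tsupport _)
    ((tsupport_mul_cutoff_subset f hc).trans Ioo_subset_Icc_self)

/-- The cutoff has slope of order c only at distance of order 1/c from the end points, where the
factor t(1-t) compensates. This gives the dominating function when c tends to infinity. -/
theorem exists_bound_mul_cutoffDeriv :
    ∃ M : ℝ, ∀ c t : ℝ, t ∈ Ioo (0 : ℝ) 1 → |t * (1 - t) * cutoffDeriv c t| ≤ M := by
  obtain ⟨M, hM0, hM⟩ := exists_bound_mul_deriv_smoothTransition
  refine ⟨M + M, fun c t ht => ?_⟩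
  have h1 := hM (c * t - 1)
  have h2 := hM (c * (1 - t) - 1)
  rw [sub_add_cancel] at h1 h2
  have e : t * (1 - t) * cutoffDeriv c t
      = (c * t * deriv Real.smoothTransition (c * t - 1)) *
          ((1 - t) * Real.smoothTransition (c * (1 - t) - 1))
        - (c * (1 - t) * deriv Real.smoothTransition (c * (1 - t) - 1)) *
          (t * Real.smoothTransition (c * t - 1)) := by
    unfold cutoffDeriv; ring
  have key (s y : ℝ) (hs : s ∈ Ioo (0 : ℝ) 1) : |s * Real.smoothTransition y| ≤ 1 := by
    rw [abs_of_nonneg (mul_nonneg hs.1.le (Real.smoothTransition.nonneg _))]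
    exact mul_le_one₀ hs.2.le (Real.smoothTransition.nonneg _) (Real.smoothTransition.le_one _)
  rw [e]
  refine (abs_sub _ _).trans (add_le_add ?_ ?_)
  · rw [abs_mul]
    exact (mul_le_mul h1 (key _ _ ⟨by linarith [ht.2], by linarith [ht.1]⟩)
      (abs_nonneg _) hM0).trans_eq (mul_one M)
  · rw [abs_mul]
    exact (mul_le_mul h2 (key _ _ ht) (abs_nonneg _) hM0).trans_eq (mul_one M)

theorem eventually_cutoff_eq {t : ℝ} (ht : t ∈ Ioo (0 : ℝ) 1) :
    ∀ᶠ n : ℕ in atTop, cutoff n t = 1 ∧ cutoffDeriv n t = 0 := by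
  have key {s : ℝ} (hs : 0 < s) : ∀ᶠ n : ℕ in atTop, 1 < (n : ℝ) * s - 1 := by
    have := (tendsto_natCast_atTop_atTop (R := ℝ)).eventually_gt_atTop (2 / s)
    filter_upwards [this] with n hn
    rw [div_lt_iff₀ hs] at hn
    linarith
  filter_upwards [key ht.1, key (sub_pos.2 ht.2)] with n h1 h2
  refine ⟨?_, ?_⟩
  · rw [cutoff, Real.smoothTransition.one_of_one_le h1.le,
      Real.smoothTransition.one_of_one_le h2.le, one_mul]
  · rw [cutoffDeriv, deriv_smoothTransition_of_gt h1, deriv_smoothTransition_of_gt h2]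
    simp

/-- Weak derivatives may be tested against polynomials vanishing at the end points. -/
theorem HasWeakDeriv.integral_polynomial {x g : L2} (h : HasWeakDeriv x g) (q : ℝ[X]) :
    ∫ t in Ioo (0 : ℝ) 1, (derivative (X * (1 - X) * q)).eval t * x t
      = -∫ t in Ioo (0 : ℝ) 1, (X * (1 - X) * q).eval t * g t := by
  set p := X * (1 - X) * q with hp
  have hpt (t : ℝ) : p.eval t = t * (1 - t) * q.eval t := by simp [hp]
  obtain ⟨M, hM⟩ := exists_bound_mul_cutoffDeriv
  set φ : ℕ → ℝ → ℝ := fun n t => p.eval t * cutoff n t with hφ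
  set D : ℕ → ℝ → ℝ := fun n t =>
    (derivative p).eval t * cutoff n t + p.eval t * cutoffDeriv n t with hD
  have hφc (n : ℕ) : ContDiff ℝ ∞ (φ n) := by
    have hp : ContDiff ℝ ∞ fun t => p.eval t := by
      simpa using p.contDiff_aeval (𝕜 := ℝ) ∞
    exact hp.mul (contDiff_cutoff n)
  have hφD (n : ℕ) : deriv (φ n) = D n :=
    funext fun t => ((p.hasDerivAt t).mul (hasDerivAt_cutoff n t)).deriv
  have hDc (n : ℕ) : Continuous (D n) := by
    rw [← hφD n]
    exact (hφc n).continuous_deriv (by simp)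
  have hn (n : ℕ) : ∫ t in Ioo (0 : ℝ) 1, D n t * x t
      = -∫ t in Ioo (0 : ℝ) 1, φ n t * g t := by
    have := h (φ n) (hφc n) (hasCompactSupport_mul_cutoff _ n.cast_nonneg)
      (tsupport_mul_cutoff_subset _ n.cast_nonneg)
    rw [hφD] at this
    simpa only [mul_comm] using this
  have hl : Tendsto (fun n => ∫ t in Ioo (0 : ℝ) 1, D n t * x t) atTop
      (𝓝 (∫ t in Ioo (0 : ℝ) 1, (derivative p).eval t * x t)) := by
    refine tendsto_integral_of_dominated_convergence
      (fun t => ‖(|(derivative p).eval t| + M * |q.eval t|) * x t‖)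
      (fun n => (integrable_continuous_mul (hDc n) x).1)
      (integrable_continuous_mul (f := fun t => |(derivative p).eval t| + M * |q.eval t|)
        (by fun_prop) x).norm ?_ ?_
    · intro n
      filter_upwards [ae_restrict_mem measurableSet_Ioo] with t ht
      rw [norm_mul, norm_mul]
      refine mul_le_mul_of_nonneg_right ?_ (norm_nonneg _)
      rw [Real.norm_eq_abs, Real.norm_eq_abs]
      refine le_trans ?_ (le_abs_self _)
      refine (abs_add_le _ _).trans (add_le_add ?_ ?_)
      · rw [abs_mul, abs_of_nonneg (cutoff_nonneg _ _)]
        exact mul_le_of_le_one_right (abs_nonneg _) (cutoff_le_one _ _)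
      · rw [hpt, mul_right_comm, abs_mul]
        exact mul_le_mul_of_nonneg_right (hM n t ht) (abs_nonneg _)
    · filter_upwards [ae_restrict_mem measurableSet_Ioo] with t ht
      refine tendsto_const_nhds.congr' ?_
      filter_upwards [eventually_cutoff_eq ht] with n hn
      simp [hD, hn.1, hn.2]
  have hr : Tendsto (fun n => ∫ t in Ioo (0 : ℝ) 1, φ n t * g t) atTop
      (𝓝 (∫ t in Ioo (0 : ℝ) 1, p.eval t * g t)) := by
    refine tendsto_integral_of_dominated_convergence (fun t => ‖p.eval t * g t‖)
      (fun n => (integrable_continuous_mul (hφc n).continuous g).1)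
      (integrable_continuous_mul p.continuous g).norm ?_ ?_
    · intro n
      refine Eventually.of_forall fun t => ?_
      rw [norm_mul, norm_mul (p.eval t) (g t)]
      refine mul_le_mul_of_nonneg_right ?_ (norm_nonneg _)
      rw [hφ, norm_mul, Real.norm_of_nonneg (cutoff_nonneg _ _)]
      exact mul_le_of_le_one_right (norm_nonneg _) (cutoff_le_one _ _)
    · filter_upwards [ae_restrict_mem measurableSet_Ioo] with t ht
      refine tendsto_const_nhds.congr' ?_
      filter_upwards [eventually_cutoff_eq ht] with n hn
      simp [hφ, hn.1]
  simp only [hn] at hl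
  exact tendsto_nhds_unique hl hr.neg

/-! ### Parseval's identity and the low-degree part -/

theorem orthonormal_normalize {E ι : Type*} [NormedAddCommGroup E] [InnerProductSpace ℝ E]
    {v : ι → E} (h0 : ∀ i, v i ≠ 0) (h : ∀ i j, i ≠ j → inner ℝ (v i) (v j) = 0) :
    Orthonormal ℝ fun i => ‖v i‖⁻¹ • v i := by
  refine ⟨fun i => ?_, fun i j hij => ?_⟩
  · rw [norm_smul, norm_inv, norm_norm, inv_mul_cancel₀ (norm_ne_zero_iff.2 (h0 i))]
  · change inner ℝ _ _ = 0
    rw [real_inner_smul_left, real_inner_smul_right, h i j hij, mul_zero, mul_zero]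

theorem inner_normalize_sq {E : Type*} [NormedAddCommGroup E] [InnerProductSpace ℝ E]
    (v x : E) : (inner ℝ (‖v‖⁻¹ • v) x) ^ 2 = inner ℝ v x ^ 2 / ‖v‖ ^ 2 := by
  rw [real_inner_smul_left, mul_pow, inv_pow, mul_comm, div_eq_mul_inv]

theorem norm_polyLp_sq (p : ℝ[X]) : ‖polyLp p‖ ^ 2 = polyIntegral (p ^ 2) := by
  rw [← real_inner_self_eq_norm_sq, inner_polyLp_polyLp, sq]

theorem polyIntegral_legendre_sq_pos (k : ℕ) : 0 < polyIntegral (legendre k ^ 2) := by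
  by_contra h
  have h1 := polyIntegral_legendre_sq_ge k
  have h2 := mul_nonpos_of_nonneg_of_nonpos (sq_nonneg ((k : ℝ) * (k + 1) + 2)) (not_lt.1 h)
  linarith

theorem norm_polyLp_legendre_pos (k : ℕ) : 0 < ‖polyLp (legendre k)‖ ^ 2 := by
  rw [norm_polyLp_sq]; exact polyIntegral_legendre_sq_pos k

theorem polyLp_legendre_ne_zero (k : ℕ) : polyLp (legendre k) ≠ 0 := fun h => by
  simpa [h] using norm_polyLp_legendre_pos k

theorem inner_polyLp_legendre {j k : ℕ} (h : j ≠ k) :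
    inner ℝ (polyLp (legendre j)) (polyLp (legendre k)) = 0 := by
  rw [inner_polyLp_polyLp, polyIntegral_legendre_mul h]

/-- The squared Legendre coefficients of `x` with respect to the normalized polynomials. -/
def legendreEnergy (x : L2) (k : ℕ) : ℝ :=
  inner ℝ (polyLp (legendre k)) x ^ 2 / ‖polyLp (legendre k)‖ ^ 2

theorem hasSum_legendreEnergy (x : L2) : HasSum (legendreEnergy x) (‖x‖ ^ 2) := by
  have ho := orthonormal_normalize polyLp_legendre_ne_zero fun j k => inner_polyLp_legendre
  have hb : (Submodule.span ℝ (Set.range fun k =>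
      ‖polyLp (legendre k)‖⁻¹ • polyLp (legendre k)))ᗮ = ⊥ := by
    refine (Submodule.eq_bot_iff _).2 fun y hy => ?_
    refine eq_zero_of_moment_eq_zero (moment_eq_zero_of_inner_legendre fun k => ?_)
    have h := (Submodule.mem_orthogonal _ _).1 hy _ (Submodule.subset_span ⟨k, rfl⟩)
    rw [real_inner_smul_left] at h
    exact (mul_eq_zero.1 h).resolve_left
      (inv_ne_zero (norm_ne_zero_iff.2 (polyLp_legendre_ne_zero k)))
  have h := (HilbertBasis.mkOfOrthogonalEqBot ho hb).hasSum_inner_mul_inner x x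
  rw [real_inner_self_eq_norm_sq, HilbertBasis.coe_mkOfOrthogonalEqBot] at h
  refine h.congr_fun fun k => ?_
  rw [legendreEnergy, ← inner_normalize_sq, sq, real_inner_comm]

theorem abs_moment_le (x : L2) (j : ℕ) : |moment x j| ≤ ‖A x‖ :=
  lp.norm_apply_le_norm (by norm_num) (A x) j

theorem mul_succ_add_two_le (k : ℕ) : k * (k + 1) + 2 ≤ 2 * 2 ^ k := by
  rcases Nat.lt_or_ge k 3 with h | h
  · interval_cases k <;> norm_num
  · induction k, h using Nat.le_induction with
    | base => norm_num
    | succ n hn ih => rw [pow_succ]; nlinarith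

/-- Here 256 = 8² · 4: the square of the coefficient sum 8^k, times the loss 4 · 4^k from the lower
bound on the norm of L_k. -/
theorem legendreEnergy_le (x : L2) (k : ℕ) :
    legendreEnergy x k ≤ 4 * 256 ^ k * ‖A x‖ ^ 2 := by
  set d := ‖A x‖
  have hd : 0 ≤ d := norm_nonneg _
  have h1 : |inner ℝ (polyLp (legendre k)) x| ≤ 8 ^ k * d := by
    rw [inner_polyLp _ (Nat.lt_succ_of_le (natDegree_legendre_le k))]
    refine (Finset.abs_sum_le_sum_abs _ _).trans ?_
    refine le_trans (Finset.sum_le_sum fun j _ => ?_)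
      ((Finset.sum_mul _ _ _).symm.le.trans
        (mul_le_mul_of_nonneg_right (sum_abs_coeff_legendre_le k) hd))
    rw [abs_mul]
    exact mul_le_mul_of_nonneg_left (abs_moment_le x j) (abs_nonneg _)
  have h2 : inner ℝ (polyLp (legendre k)) x ^ 2 ≤ 64 ^ k * d ^ 2 := by
    rw [← sq_abs]
    calc _ ≤ (8 ^ k * d) ^ 2 := pow_le_pow_left₀ (abs_nonneg _) h1 2
      _ = 64 ^ k * d ^ 2 := by rw [mul_pow, ← pow_mul, mul_comm k 2, pow_mul]; norm_num
  have hk' : (k : ℝ) * (k + 1) + 2 ≤ 2 * 2 ^ k := by exact_mod_cast mul_succ_add_two_le k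
  have h3 : 1 ≤ 4 * 4 ^ k * ‖polyLp (legendre k)‖ ^ 2 := by
    rw [norm_polyLp_sq]
    refine (polyIntegral_legendre_sq_ge k).trans
      (mul_le_mul_of_nonneg_right ?_ (polyIntegral_legendre_sq_pos k).le)
    calc _ ≤ (2 * 2 ^ k : ℝ) ^ 2 := pow_le_pow_left₀ (by positivity) hk' 2
      _ = 4 * 4 ^ k := by rw [mul_pow, ← pow_mul, mul_comm k 2, pow_mul]; norm_num
  rw [legendreEnergy, div_le_iff₀ (norm_polyLp_legendre_pos k)]
  have e : (256 : ℝ) ^ k = 64 ^ k * 4 ^ k := by rw [← mul_pow]; norm_num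
  rw [e]
  calc _ ≤ 64 ^ k * d ^ 2 * 1 := by rw [mul_one]; exact h2
    _ ≤ 64 ^ k * d ^ 2 * (4 * 4 ^ k * ‖polyLp (legendre k)‖ ^ 2) :=
        mul_le_mul_of_nonneg_left h3 (by positivity)
    _ = _ := by ring

theorem sum_legendreEnergy_le (x : L2) (n : ℕ) :
    ∑ k ∈ Finset.range n, legendreEnergy x k ≤ 256 ^ n * ‖A x‖ ^ 2 := by
  induction n with
  | zero => simp
  | succ n ih =>
    rw [Finset.sum_range_succ, pow_succ]
    have h1 := legendreEnergy_le x n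
    have h2 : 0 ≤ (256 : ℝ) ^ n * ‖A x‖ ^ 2 := by positivity
    linarith

/-! ### Weighted derivatives and the high-degree part -/

/-- The weighted derivative `√(t (1 - t)) L_k'` of a Legendre polynomial. -/
def legendreDerivLp (k : ℕ) : L2 :=
  contLp (fun t => √(t * (1 - t)) * (derivative (legendre k)).eval t)
    (by fun_prop)

theorem inner_legendreDerivLp (j k : ℕ) :
    inner ℝ (legendreDerivLp j) (legendreDerivLp k)
      = (j : ℝ) * (j + 1) * inner ℝ (polyLp (legendre j)) (polyLp (legendre k)) := by
  rw [inner_polyLp_polyLp, ← polyIntegral_weighted, legendreDerivLp, legendreDerivLp,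
    inner_contLp_contLp, polyIntegral_apply]
  refine intervalIntegral.integral_congr fun t ht => ?_
  rw [uIcc_of_le zero_le_one] at ht
  have hw : √(t * (1 - t)) * √(t * (1 - t)) = t * (1 - t) :=
    Real.mul_self_sqrt (mul_nonneg ht.1 (sub_nonneg.2 ht.2))
  simp only [eval_mul, eval_X, eval_sub, eval_one]
  linear_combination ((derivative (legendre j)).eval t * (derivative (legendre k)).eval t) * hw

theorem norm_legendreDerivLp_sq (k : ℕ) :
    ‖legendreDerivLp k‖ ^ 2 = (k : ℝ) * (k + 1) * ‖polyLp (legendre k)‖ ^ 2 := by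
  rw [← real_inner_self_eq_norm_sq, ← real_inner_self_eq_norm_sq, inner_legendreDerivLp]

theorem sqrt_mul_one_sub_le (t : ℝ) : √(t * (1 - t)) ≤ 1 / 2 :=
  Real.sqrt_le_iff.2 ⟨by norm_num, by nlinarith [sq_nonneg (t - 1 / 2)]⟩

theorem memLp_sqrt_mul (g : L2) :
    MemLp (fun t => √(t * (1 - t)) * g t) 2 (volume.restrict (Ioo (0 : ℝ) 1)) := by
  refine (Lp.memLp g).of_le_mul (c := 1 / 2)
    ((by fun_prop : Continuous fun t : ℝ => √(t * (1 - t))).aestronglyMeasurable.mul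
      (Lp.memLp g).1) (Eventually.of_forall fun t => ?_)
  rw [norm_mul, Real.norm_of_nonneg (Real.sqrt_nonneg _)]
  exact mul_le_mul_of_nonneg_right (sqrt_mul_one_sub_le t) (norm_nonneg _)

theorem norm_sqrt_mul_le (g : L2) : ‖(memLp_sqrt_mul g).toLp‖ ≤ 1 / 2 * ‖g‖ := by
  refine Lp.norm_le_mul_norm_of_ae_le_mul ?_
  filter_upwards [(memLp_sqrt_mul g).coeFn_toLp] with t ht
  rw [ht, norm_mul, Real.norm_of_nonneg (Real.sqrt_nonneg _)]
  exact mul_le_mul_of_nonneg_right (sqrt_mul_one_sub_le t) (norm_nonneg _)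

/-- Test the weak derivative against t(1-t) L_k' and apply the Legendre equation; each factor of the
inner product carries one square root of the weight. -/
theorem HasWeakDeriv.inner_legendreDerivLp {x g : L2} (h : HasWeakDeriv x g) (k : ℕ) :
    inner ℝ (legendreDerivLp k) (memLp_sqrt_mul g).toLp
      = (k : ℝ) * (k + 1) * inner ℝ (polyLp (legendre k)) x := by
  have h1 := h.integral_polynomial (derivative (legendre k))
  rw [legendre_ode] at h1
  simp only [eval_mul, eval_neg, eval_C, neg_mul, mul_assoc, integral_neg,
    integral_const_mul] at h1
  rw [polyLp, inner_contLp, legendreDerivLp, inner_contLp]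
  refine Eq.trans ?_ ((neg_inj.1 h1).symm.trans (mul_assoc _ _ _).symm)
  refine integral_congr_ae ?_
  filter_upwards [(memLp_sqrt_mul g).coeFn_toLp, ae_restrict_mem measurableSet_Ioo] with t ht hI
  have hw : √(t * (1 - t)) * √(t * (1 - t)) = t * (1 - t) :=
    Real.mul_self_sqrt (mul_nonneg hI.1.le (sub_nonneg.2 hI.2.le))
  rw [ht]
  simp only [eval_X, eval_sub, eval_one]
  linear_combination ((derivative (legendre k)).eval t * g t) * hw

/-- Bessel's inequality; the factor 1/4 is the maximum of t(1-t). Degrees are shifted by one because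
L_0' = 0 cannot be normalized. -/
theorem HasWeakDeriv.sum_mul_legendreEnergy_le {x g : L2} (h : HasWeakDeriv x g) {n : ℕ}
    (hn : 1 ≤ n) (m : ℕ) :
    ∑ k ∈ Finset.Ico n m, (k : ℝ) * (k + 1) * legendreEnergy x k ≤ 1 / 4 * ‖g‖ ^ 2 := by
  have hpos (k : ℕ) : (0 : ℝ) < ((k + 1 : ℕ) : ℝ) * ((k + 1 : ℕ) + 1) := by positivity
  have h0 (k : ℕ) : legendreDerivLp (k + 1) ≠ 0 := fun h => by
    have h1 := norm_legendreDerivLp_sq (k + 1)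
    have h2 := mul_pos (hpos k) (norm_polyLp_legendre_pos (k + 1))
    rw [← h1, h] at h2
    simp at h2
  have ho := orthonormal_normalize h0 fun i j hij => by
    rw [HausdorffMoment.inner_legendreDerivLp, inner_polyLp_legendre (by omega), mul_zero]
  obtain ⟨n, rfl⟩ := Nat.exists_eq_add_of_le' hn
  have hB := ho.sum_inner_products_le (memLp_sqrt_mul g).toLp (s := Finset.Ico n (m - 1))
  have hG : ‖(memLp_sqrt_mul g).toLp‖ ^ 2 ≤ 1 / 4 * ‖g‖ ^ 2 := by
    calc _ ≤ (1 / 2 * ‖g‖) ^ 2 := pow_le_pow_left₀ (norm_nonneg _) (norm_sqrt_mul_le g) 2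
      _ = _ := by ring
  refine le_trans (le_of_eq ?_) (hB.trans hG)
  rcases Nat.eq_zero_or_pos m with rfl | hm
  · simp
  obtain ⟨m, rfl⟩ := Nat.exists_eq_add_of_le' hm
  rw [Nat.add_sub_cancel, ← Finset.sum_Ico_add']
  refine Finset.sum_congr rfl fun k _ => ?_
  rw [Real.norm_eq_abs, sq_abs, inner_normalize_sq, h.inner_legendreDerivLp,
    norm_legendreDerivLp_sq, legendreEnergy]
  have h3 := (norm_polyLp_legendre_pos (k + 1)).ne'
  have h4 := (hpos k).ne'
  generalize ((k + 1 : ℕ) : ℝ) * ((k + 1 : ℕ) + 1) = l at *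
  field_simp

theorem legendreEnergy_nonneg (x : L2) (k : ℕ) : 0 ≤ legendreEnergy x k := by
  unfold legendreEnergy; positivity

/-! ### Stability estimate and choice of the degree -/

/-- Conditional stability of the Hausdorff moment problem with `n` as a free parameter. -/
theorem HasWeakDeriv.norm_le {x g : L2} (h : HasWeakDeriv x g) {n : ℕ} (hn : 1 ≤ n) :
    ‖x‖ ≤ 16 ^ n * ‖A x‖ + ‖g‖ / (2 * n) := by
  have hn0 : (0 : ℝ) < n := by exact_mod_cast hn
  have htail (m : ℕ) : ∑ k ∈ Finset.Ico n m, legendreEnergy x k ≤ (‖g‖ / (2 * n)) ^ 2 := by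
    have h1 : (n : ℝ) ^ 2 * ∑ k ∈ Finset.Ico n m, legendreEnergy x k ≤ 1 / 4 * ‖g‖ ^ 2 := by
      refine le_trans ?_ (h.sum_mul_legendreEnergy_le hn m)
      rw [Finset.mul_sum]
      refine Finset.sum_le_sum fun k hk => ?_
      refine mul_le_mul_of_nonneg_right ?_ (legendreEnergy_nonneg x k)
      have : (n : ℝ) ≤ k := by exact_mod_cast (Finset.mem_Ico.1 hk).1
      nlinarith
    rw [div_pow, le_div_iff₀ (by positivity)]
    linarith
  have hsq : ‖x‖ ^ 2 ≤ 256 ^ n * ‖A x‖ ^ 2 + (‖g‖ / (2 * n)) ^ 2 := by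
    refine le_of_tendsto (hasSum_legendreEnergy x).tendsto_sum_nat ?_
    filter_upwards [eventually_ge_atTop n] with m hm
    rw [← Finset.sum_range_add_sum_Ico _ hm]
    exact add_le_add (sum_legendreEnergy_le x n) (htail m)
  refine abs_le_of_sq_le_sq' ?_ (by positivity) |>.2
  have e : (256 : ℝ) ^ n = (16 ^ n) ^ 2 := by rw [← pow_mul, mul_comm n 2, pow_mul]; norm_num
  rw [e] at hsq
  -- The cross term in the square of the sum is nonnegative.
  have : 0 ≤ 16 ^ n * ‖A x‖ * (‖g‖ / (2 * n)) := by positivity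
  nlinarith

theorem norm_weakDeriv_le_h1Norm (x : L2) : ‖weakDeriv x‖ ≤ h1Norm x :=
  Real.le_sqrt_of_sq_le (by nlinarith [sq_nonneg ‖x‖])

theorem norm_le_of_mem_h1Ball {E : ℝ} {x : L2} (hx : x ∈ h1Ball E) {n : ℕ} (hn : 1 ≤ n) :
    ‖x‖ ≤ 16 ^ n * ‖A x‖ + E / (2 * n) :=
  ((hasWeakDeriv_weakDeriv hx.1).norm_le hn).trans
    (by gcongr; exact (norm_weakDeriv_le_h1Norm x).trans hx.2)

/-- As ln 16 ≤ 2.8, n ≤ l/4 bounds the first term by exp(-0.3 l) ≤ 1/(5l). Rounding l/4 down costs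
little for large l, so the second is at most 11/(5l), and 12/5 ≤ 7/√8. -/
theorem pow_mul_exp_neg_add_le {l : ℝ} (hl : 200 ≤ l) :
    ∃ n : ℕ, 1 ≤ n ∧ 16 ^ n * Real.exp (-l) + 1 / (2 * n) ≤ 7 / √8 * l⁻¹ := by
  have hl0 : 0 < l := by linarith
  refine ⟨⌊l / 4⌋₊, Nat.le_floor (by norm_num; linarith), ?_⟩
  set n := ⌊l / 4⌋₊
  have h1 : (n : ℝ) ≤ l / 4 := Nat.floor_le (by positivity)
  have h2 : l / 4 < n + 1 := Nat.lt_floor_add_one _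
  have hlog : Real.log 16 ≤ 2.8 := by
    have : Real.log 16 = 4 * Real.log 2 := by
      rw [show (16 : ℝ) = 2 ^ 4 by norm_num, Real.log_pow]; norm_num
    have := Real.log_two_lt_d9
    linarith
  have h3 : (16 : ℝ) ^ n * Real.exp (-l) ≤ 1 / 5 * l⁻¹ := by
    have e1 : (16 : ℝ) ^ n = Real.exp (n * Real.log 16) := by
      rw [mul_comm, Real.exp_mul, Real.exp_log (by norm_num), Real.rpow_natCast]
    rw [e1, ← Real.exp_add]
    have e2 : (n : ℝ) * Real.log 16 + -l ≤ -(0.3 * l) := by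
      have : (n : ℝ) * Real.log 16 ≤ l / 4 * 2.8 :=
        mul_le_mul h1 hlog (Real.log_nonneg (by norm_num)) (by positivity)
      linarith
    refine (Real.exp_le_exp.2 e2).trans ?_
    rw [Real.exp_neg, ← one_div, ← div_eq_mul_inv, div_le_div_iff₀ (Real.exp_pos _) hl0]
    have := Real.quadratic_le_exp_of_nonneg (x := 0.3 * l) (by positivity)
    nlinarith
  have h4 : 1 / (2 * (n : ℝ)) ≤ 11 / 5 * l⁻¹ := by
    rw [← div_eq_mul_inv, div_le_div_iff₀ (by linarith) hl0]
    linarith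
  have h5 : 12 / 5 ≤ 7 / √8 := by
    have h8 : √8 ≤ 35 / 12 := Real.sqrt_le_iff.2 ⟨by norm_num, by norm_num⟩
    rw [div_le_div_iff₀ (by norm_num) (by positivity)]
    linarith
  have := mul_le_mul_of_nonneg_right h5 (inv_nonneg.2 hl0.le)
  linarith

theorem norm_le_log_of_mem_h1Ball {E δ : ℝ} (hE : 0 < E) {x : L2} (hx : x ∈ h1Ball E)
    (hδ : 0 < δ) (hA : ‖A x‖ ≤ δ) (hδE : δ / E ≤ Real.exp (-200)) :
    ‖x‖ ≤ 7 / √8 * E * (-Real.log (δ / E))⁻¹ := by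
  have hr : 0 < δ / E := div_pos hδ hE
  have hl : 200 ≤ -Real.log (δ / E) := by
    have := Real.log_le_log hr hδE
    rw [Real.log_exp] at this
    linarith
  obtain ⟨n, hn, h⟩ := pow_mul_exp_neg_add_le hl
  rw [neg_neg, Real.exp_log hr] at h
  have hmul := mul_le_mul_of_nonneg_left h hE.le
  calc ‖x‖ ≤ 16 ^ n * ‖A x‖ + E / (2 * n) := norm_le_of_mem_h1Ball hx hn
    _ ≤ 16 ^ n * δ + E / (2 * n) := by gcongr
    _ = E * (16 ^ n * (δ / E) + 1 / (2 * n)) := by field_simp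
    _ ≤ _ := hmul
    _ = _ := by ring

end HausdorffMoment

end

theorem mainTheorem2 :
    (∃ C : ℝ, 0 < C ∧ ∃ ε : ℝ, 0 < ε ∧
      ∀ (E : ℝ), 0 < E → ∀ x : HausdorffMoment.L2,
        HausdorffMoment.MemH1 x → HausdorffMoment.h1Norm x ≤ E →
        ∀ δ : ℝ, δ = ‖HausdorffMoment.A x‖ → δ / E ≤ ε →
          ‖x‖ ≤ 7 / Real.sqrt 8 * E * (-Real.log (C * (δ / E)))⁻¹) ∧
    ((fun δ : ℝ => HausdorffMoment.modulus (HausdorffMoment.h1Ball 1) δ)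
      =O[𝓝[>] (0 : ℝ)] fun δ : ℝ => 1 / Real.log (1 / δ)) := by
  -- C = 1 suffices; ε = exp(-200) forces l ≥ 200.
  refine ⟨⟨1, one_pos, Real.exp (-200), Real.exp_pos _, ?_⟩, ?_⟩
  · rintro E hE x hx hxE δ rfl hδ
    rw [one_mul]
    rcases (norm_nonneg (HausdorffMoment.A x)).eq_or_lt with h | h
    -- For δ = 0 the right side is 0, since `Real.log 0 = 0` and `0⁻¹ = 0`; injectivity of `A` is
    -- what is needed.
    · rw [HausdorffMoment.eq_zero_of_moment_eq_zero fun j =>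
        abs_nonpos_iff.1 ((HausdorffMoment.abs_moment_le x j).trans_eq h.symm)]
      simp
    · exact HausdorffMoment.norm_le_log_of_mem_h1Ball hE ⟨hx, hxE⟩ h le_rfl hδ
  · refine IsBigO.of_bound (7 / √8) ?_
    filter_upwards [Ioc_mem_nhdsGT (Real.exp_pos (-200))] with δ hδ
    have hlog : Real.log (1 / δ) = -Real.log δ := by rw [one_div, Real.log_inv]
    have hneg : Real.log δ ≤ -200 := by
      simpa using Real.log_le_log hδ.1 hδ.2
    rw [hlog, one_div, Real.norm_of_nonneg (r := (-Real.log δ)⁻¹)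
      (inv_nonneg.2 (by linarith)), Real.norm_of_nonneg]
    · refine Real.sSup_le ?_ (mul_nonneg (by positivity) (inv_nonneg.2 (by linarith)))
      rintro r ⟨x, hx, hA, rfl⟩
      simpa using HausdorffMoment.norm_le_log_of_mem_h1Ball one_pos hx hδ.1 hA (by simpa using hδ.2)
    · refine Real.sSup_nonneg ?_
      rintro r ⟨x, -, -, rfl⟩
      exact norm_nonneg x
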